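/- For $n\ge 1$ let $\alpha_{n1},\dots,\alpha_{nn}$ be the (simple) zeros of the Bessel polynomial $y_n(z)=\sum_{k=0}^{n}\frac{(n+k)!}{(n-k)!\,k!}\left(\frac z2\right)^k$, and put $a_{nk}=1-\alpha_{nk}/2$, $b_{nk}=1+\alpha_{nk}/2$. For $f(z)=\sum_{m\ge0}f_mz^m$ analytic in the unit disk $|z|<1$ put $$r_n(f;z)=zf'(z)-\sum_{k=1}^n\bigl(f(a_{nk}z)-f(b_{nk}z)\bigr),$$ and let $n_0(x)=\max\{14,\,x^2/(1-x)^2\}-1$. (1) If $|f_m|\le1$ for all $m\ge0$, $x\in(0,1)$ and $n\ge n_0(x)$, then $$|r_n(f;z)|\le \frac{|z|^{2n+1}}{x-|z|}\cdot\frac{2x}{(1-x)^{2n+2}}\cdot\frac{n!^2}{(2n)!^2}=:B_n(x,|z|)\qquad(|z|<x).$$ (2) Up to the factor $2x/(x-|z|)$ this estimate is sharp in order in $n$ for $|z|$ close to $x$: for every $u\in\mathbb C$ with $|u|=1$ there is a function $f$ with $|f_m|\le 1$ for all $m$ such that for all $x\in(0,1)$ and all $n\ge n_0(x)$ $$|r_n(f;tu)|\ge\frac{t^{2n+1}}{(1-t)^{2n+2}}\cdot\frac{n!^2}{(2n)!^2}\qquad(0\le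 t\le x)$$ (in particular $|r_n(f;xu)|\ge \frac{x^{2n+1}}{(1-x)^{2n+2}}\frac{n!^2}{(2n)!^2}$), and consequently $$|r_n(f;tu)|\ge e^{-2}\,\frac{x-t}{2x}\,B_n(x,t)=e^{-2}\,\frac{t^{2n+1}}{(1-x)^{2n+2}}\cdot\frac{n!^2}{(2n)!^2}\qquad\text{whenever } 0\le t<x,\ x-t\le\frac{1-x}{n+1}.$$ (3) In particular, if $|f_m|\le1$ for all $m$, $n\ge13$ and $x_n=\sqrt n/(1+\sqrt n)$, then $$|r_n(f;z)|\le\frac{|z|^{2n+1}}{x_n-|z|}\cdot\frac{0.92^{2n}}{n^{n-1}}\qquad(|z|<x_n).$$ -/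

import Mathlib

open scoped Nat

noncomputable section

/-- The `n`-th Bessel polynomial
`y_n(z) = ∑_{k=0}^n (n+k)! / ((n-k)! k!) * (z/2)^k`, with complex coefficients. -/
def besselPoly (n : ℕ) : Polynomial ℂ :=
  ∑ k ∈ Finset.range (n + 1),
    Polynomial.C ((((n + k)! : ℕ) : ℂ) / ((((n - k)! : ℕ) : ℂ) * ((k ! : ℕ) : ℂ)) / 2 ^ k) *
      Polynomial.X ^ k

/-- The differentiating sum `∑_{k=1}^n (f(a_{nk} z) - f(b_{nk} z))`, where
`a_{nk} = 1 - α_{nk}/2`, `b_{nk} = 1 + α_{nk}/2` and `α_{n1}, …, α_{nn}` are the zeros of `y_n`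
(the multiset of all complex roots). -/
def diffSum (n : ℕ) (f : ℂ → ℂ) (z : ℂ) : ℂ :=
  ((besselPoly n).roots.map fun α => f ((1 - α / 2) * z) - f ((1 + α / 2) * z)).sum

/-- The remainder `r_n(f; z) = z f'(z) - ∑_{k=1}^n (f(a_{nk} z) - f(b_{nk} z))`. -/
def diffRemainder (n : ℕ) (f : ℂ → ℂ) (z : ℂ) : ℂ :=
  z * deriv f z - diffSum n f z

/-- `f` is, on the open unit disk, the sum of a power series `∑ f_m z^m` all of whose
coefficients satisfy `|f_m| ≤ 1`. -/
def HasUnitTaylorCoeffs (f : ℂ → ℂ) : Prop :=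
  ∃ c : ℕ → ℂ, (∀ m, ‖c m‖ ≤ 1) ∧
    ∀ z : ℂ, ‖z‖ < 1 → HasSum (fun m : ℕ => c m * z ^ m) (f z)

/-- `n_0(x) = max {14, x² / (1-x)²} - 1`. -/
def nZero (x : ℝ) : ℝ := max 14 (x ^ 2 / (1 - x) ^ 2) - 1

/-- `γ_n = n!² / (2n)!²`. -/
def gammaCoeff (n : ℕ) : ℝ := ((n ! : ℕ) : ℝ) ^ 2 / (((2 * n)! : ℕ) : ℝ) ^ 2

/-- The bound `t^{2n+1} / (x - t) * (2x / (1-x)^{2n+2}) * n!² / (2n)!²`, where `t = |z|`. -/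
def remainderBound (n : ℕ) (x t : ℝ) : ℝ :=
  t ^ (2 * n + 1) / (x - t) * (2 * x / (1 - x) ^ (2 * n + 2)) * gammaCoeff n

end

open Polynomial

/-! The remainder is first computed for the geometric series. Let P(w) = ∏ (1 - αw/2), Q(w) = P(-w),
V = PQ and w = z/(1-z). Since 1 - a z = (1-z)(1 + αw/2) and 1 - b z = (1-z)(1 - αw/2), the
differentiating sum for 1/(1-z) is a combination of logarithmic derivatives of P and Q, and the
remainder equals w/(1-z) times (PQ + PQ' - P'Q)/V. The confluent hypergeometric equation of P forces
this numerator to be a monomial (`padeWronskian_eq`), so the remainder is ± γ_n z^(2n+1) /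
((1-z)^(2n+2) V(w)) (`diffRemainder_geometric`).

It remains to control V. A product of solutions of second-order equations satisfies a third-order
one, which here gives a two-term recurrence with rapidly decreasing even coefficients. For |w|² ≤
n+1 this yields |V(w)| ≥ 1/2, and |V(w)| ≤ 1 if w is also real.

The lower bound on |V| also keeps the nodes a z, b z in the unit disk for |z| ≤ x. Hence the
functional acts on power series termwise, z^m being multiplied by `remainderCoeff n m`. These
factors are the Taylor coefficients of the geometric remainder: they vanish for m ≤ 2n and otherwise
obey Cauchy's estimate (`remainderCoeff_bound`). Summing a geometric series gives the bound for
every f. The upper bound on |V| makes a rotated geometric series the extremal example, and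
Stirling's formula gives the explicit constants for x = x_n. -/

/-! ### The Padé polynomials and their differential equations -/

/-- The diagonal Padé numerator of the exponential function, `∏ (1 - α w / 2)` over the zeros `α`
of the Bessel polynomial. -/
noncomputable def padeNum (n : ℕ) : ℂ[X] :=
  ∑ k ∈ Finset.range (n + 1),
    C ((((2 * n - k)! : ℕ) : ℂ) * ((n ! : ℕ) : ℂ) /
      (((k ! : ℕ) : ℂ) * (((n - k)! : ℕ) : ℂ) * (((2 * n)! : ℕ) : ℂ))) * X ^ k

theorem padeNum_coeff (n k : ℕ) : (padeNum n).coeff k = if k ≤ n then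
    (((2 * n - k)! : ℕ) : ℂ) * ((n ! : ℕ) : ℂ) /
      (((k ! : ℕ) : ℂ) * (((n - k)! : ℕ) : ℂ) * (((2 * n)! : ℕ) : ℂ)) else 0 := by
  simp only [padeNum, finsetSum_coeff, coeff_C_mul, coeff_X_pow]
  simp

theorem padeNum_natDegree_le (n : ℕ) : (padeNum n).natDegree ≤ n := by
  rw [natDegree_le_iff_coeff_eq_zero]
  intro k hk
  rw [padeNum_coeff, if_neg (by omega)]

theorem padeNum_coeff_zero (n : ℕ) : (padeNum n).coeff 0 = 1 := by
  rw [padeNum_coeff]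
  have h1 : ((n ! : ℕ) : ℂ) ≠ 0 := by exact_mod_cast n.factorial_ne_zero
  have h2 : (((2 * n)! : ℕ) : ℂ) ≠ 0 := by exact_mod_cast (2 * n).factorial_ne_zero
  simp
  field_simp

theorem padeNum_coeff_self (n : ℕ) :
    (padeNum n).coeff n = ((n ! : ℕ) : ℂ) / (((2 * n)! : ℕ) : ℂ) := by
  rw [padeNum_coeff]
  have h1 : ((n ! : ℕ) : ℂ) ≠ 0 := by exact_mod_cast n.factorial_ne_zero
  have h2 : (((2 * n)! : ℕ) : ℂ) ≠ 0 := by exact_mod_cast (2 * n).factorial_ne_zero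
  have : 2 * n - n = n := by omega
  simp [this]
  field_simp

theorem padeNum_coeff_succ (n k : ℕ) :
    ((k : ℂ) + 1) * (2 * n - k) * (padeNum n).coeff (k + 1) = (n - k) * (padeNum n).coeff k := by
  rcases lt_trichotomy k n with h | rfl | h
  -- Parametrizing n by k and m removes every truncated subtraction from the factorials.
  · obtain ⟨m, rfl⟩ : ∃ m, n = k + 1 + m := ⟨n - k - 1, by omega⟩
    rw [padeNum_coeff, padeNum_coeff, if_pos (by omega), if_pos (by omega)]
    have e1 : 2 * (k + 1 + m) - (k + 1) = k + 1 + 2 * m := by omega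
    have e2 : 2 * (k + 1 + m) - k = k + 1 + 2 * m + 1 := by omega
    have e3 : k + 1 + m - (k + 1) = m := by omega
    have e4 : k + 1 + m - k = m + 1 := by omega
    rw [e1, e2, e3, e4, Nat.factorial_succ (k + 1 + 2 * m), Nat.factorial_succ k,
      Nat.factorial_succ m]
    have h2 : (((2 * (k + 1 + m))! : ℕ) : ℂ) ≠ 0 := by
      exact_mod_cast Nat.factorial_ne_zero _
    have h3 : ((k ! : ℕ) : ℂ) ≠ 0 := by exact_mod_cast Nat.factorial_ne_zero _
    have h4 : ((m ! : ℕ) : ℂ) ≠ 0 := by exact_mod_cast Nat.factorial_ne_zero _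
    have h5 : (k : ℂ) + 1 ≠ 0 := by exact_mod_cast Nat.succ_ne_zero k
    have h6 : (m : ℂ) + 1 ≠ 0 := by exact_mod_cast Nat.succ_ne_zero m
    push_cast
    field_simp
    ring
  · rw [padeNum_coeff, if_neg (by omega)]; simp
  · rw [padeNum_coeff, padeNum_coeff, if_neg (by omega), if_neg (by omega)]; simp

/-- Kummer's equation for ₁F₁(-n; -2n; w), which is the coefficient recurrence in differential form.
-/
theorem padeNum_ode (n : ℕ) :
    X * derivative (derivative (padeNum n)) =
      (C (2 * (n : ℂ)) + X) * derivative (padeNum n) - C (n : ℂ) * padeNum n := by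
  ext k
  have h := padeNum_coeff_succ n k
  rcases k with _ | k
  · simp [coeff_derivative, add_mul, mul_coeff_zero] at h ⊢
    linear_combination -h
  · simp only [add_mul, coeff_sub, coeff_add, coeff_X_mul, coeff_C_mul, coeff_derivative] at h ⊢
    push_cast at h ⊢
    linear_combination -h

/-- The reflected numerator `w ↦ padeNum n (-w)`. -/
noncomputable def padeDen (n : ℕ) : ℂ[X] := (padeNum n).comp (-X)

theorem padeDen_eval (n : ℕ) (w : ℂ) : (padeDen n).eval w = (padeNum n).eval (-w) := by
  simp [padeDen]

theorem padeDen_derivative_eval (n : ℕ) (w : ℂ) :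
    (derivative (padeDen n)).eval w = -(derivative (padeNum n)).eval (-w) := by
  simp [padeDen, derivative_comp]

theorem padeDen_ode (n : ℕ) :
    X * derivative (derivative (padeDen n)) =
      (C (2 * (n : ℂ)) - X) * derivative (padeDen n) + C (n : ℂ) * padeDen n := by
  have h := congrArg (fun p : ℂ[X] => p.comp (-X)) (padeNum_ode n)
  simp only [mul_comp, add_comp, sub_comp, X_comp, C_comp] at h
  simp only [padeDen, derivative_comp, derivative_mul, derivative_neg, derivative_X,
    derivative_one]
  simp only [neg_zero]
  linear_combination -h

theorem padeDen_natDegree_le (n : ℕ) : (padeDen n).natDegree ≤ n := by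
  refine natDegree_comp_le.trans ?_
  simpa using padeNum_natDegree_le n

theorem padeDen_coeff (n k : ℕ) : (padeDen n).coeff k = (-1) ^ k * (padeNum n).coeff k := by
  rw [padeDen, show (-X : ℂ[X]) = C (-1) * X by simp, comp_C_mul_X_coeff, mul_comm]

/-! ### The product V = PQ and the Wronskian identity -/

/-- The product `∏ (1 - α² w² / 4)` over the zeros `α` of the Bessel polynomial. -/
noncomputable def padeProd (n : ℕ) : ℂ[X] := padeNum n * padeDen n

theorem padeProd_natDegree_le (n : ℕ) : (padeProd n).natDegree ≤ 2 * n := by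
  refine natDegree_mul_le.trans ?_
  have := padeNum_natDegree_le n
  have := padeDen_natDegree_le n
  omega

theorem padeProd_coeff_zero (n : ℕ) : (padeProd n).coeff 0 = 1 := by
  rw [padeProd, mul_coeff_zero, padeDen_coeff, padeNum_coeff_zero]; simp

/-- The Wronskian-type combination `P Q + P Q' - P' Q`. -/
noncomputable def padeWronskian (n : ℕ) : ℂ[X] :=
  padeNum n * padeDen n + padeNum n * derivative (padeDen n) - derivative (padeNum n) * padeDen n

/-- The second derivatives of P and Q cancel against their equations, leaving Euler's equation,
whose polynomial solutions are the multiples of w^(2n). -/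
theorem padeWronskian_ode (n : ℕ) :
    X * derivative (padeWronskian n) = C (2 * (n : ℂ)) * padeWronskian n := by
  simp only [padeWronskian, derivative_sub, derivative_add, derivative_mul]
  have h1 := padeNum_ode n
  have h2 := padeDen_ode n
  simp only [map_mul, map_ofNat] at *
  linear_combination padeNum n * h2 - padeDen n * h1

theorem padeWronskian_eq {n : ℕ} (hn : 1 ≤ n) :
    padeWronskian n = C ((-1) ^ n * (gammaCoeff n : ℂ)) * X ^ (2 * n) := by
  have hP := padeNum_natDegree_le n
  have hQ := padeDen_natDegree_le n
  ext k
  rw [coeff_C_mul, coeff_X_pow]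
  by_cases hk : k = 2 * n
  · subst hk
    -- The terms with a derivative have degree at most 2n - 1, so only the product of the two
    -- leading coefficients contributes; this fixes the constant γ_n.
    have h1 : (padeNum n * derivative (padeDen n)).coeff (2 * n) = 0 := by
      apply coeff_eq_zero_of_natDegree_lt
      have := natDegree_mul_le (p := padeNum n) (q := derivative (padeDen n))
      have := natDegree_derivative_le (padeDen n)
      omega
    have h2 : (derivative (padeNum n) * padeDen n).coeff (2 * n) = 0 := by
      apply coeff_eq_zero_of_natDegree_lt
      have := natDegree_mul_le (p := derivative (padeNum n)) (q := padeDen n)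
      have := natDegree_derivative_le (padeNum n)
      omega
    have h3 : (padeNum n * padeDen n).coeff (2 * n) =
        (padeNum n).coeff n * (padeDen n).coeff n := by
      rw [two_mul]; exact coeff_mul_add_eq_of_natDegree_le hP hQ
    rw [padeWronskian, coeff_sub, coeff_add, h1, h2, h3, padeDen_coeff, padeNum_coeff_self,
      gammaCoeff]
    simp
    ring
  · rw [if_neg hk, mul_zero]
    have h := congrArg (fun p : ℂ[X] => p.coeff k) (padeWronskian_ode n)
    simp only [coeff_C_mul] at h
    have h4 : (X * derivative (padeWronskian n)).coeff k = k * (padeWronskian n).coeff k := by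
      rcases k with _ | k
      · simp
      · rw [coeff_X_mul, coeff_derivative]; push_cast; ring
    rw [h4] at h
    have h5 : ((k : ℂ) - 2 * n) * (padeWronskian n).coeff k = 0 := by linear_combination h
    rcases mul_eq_zero.1 h5 with h6 | h6
    · exact absurd (by exact_mod_cast sub_eq_zero.1 h6) hk
    · exact h6

/-- With E = w²V'' - 2nwV', the equations of P and Q give E = w²(2P'Q' - (PQ' - P'Q));
differentiating once more closes the system in V. Every term either preserves the degree or raises
it by two, whence the two-term recurrence that follows. -/
theorem padeProd_ode (n : ℕ) :
    X * derivative (X ^ 2 * derivative (derivative (padeProd n))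
        - C (2 * (n : ℂ)) * (X * derivative (padeProd n))) =
      C (4 * (n : ℂ) + 2) * (X ^ 2 * derivative (derivative (padeProd n))
        - C (2 * (n : ℂ)) * (X * derivative (padeProd n))) +
      X ^ 2 * (X * derivative (padeProd n) - C (2 * (n : ℂ)) * padeProd n) := by
  have h1 := padeNum_ode n
  have h2 := padeDen_ode n
  set P := padeNum n
  set Q := padeDen n
  have hE : X ^ 2 * derivative (derivative (padeProd n))
      - C (2 * (n : ℂ)) * (X * derivative (padeProd n)) =
      X ^ 2 * (2 * (derivative P * derivative Q) - (P * derivative Q - derivative P * Q)) := by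
    simp only [padeProd, derivative_add, derivative_mul]
    simp only [map_mul, map_ofNat] at *
    linear_combination X * Q * h1 + X * P * h2
  rw [hE]
  simp only [padeProd, derivative_sub, derivative_mul, derivative_X_pow,
    derivative_ofNat]
  simp only [map_mul, map_ofNat, map_add] at *
  simp only [Nat.cast_ofNat, map_ofNat, Nat.reduceSub, pow_one]
  linear_combination (2 * X ^ 2 * derivative Q + X ^ 2 * Q) * h1 +
    (2 * X ^ 2 * derivative P - X ^ 2 * P) * h2

theorem padeProd_coeff_rec (n k : ℕ) :
    ((k : ℂ) + 2) * (k + 1 - 2 * n) * (k - 4 * n) * (padeProd n).coeff (k + 2) =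
      (k - 2 * n) * (padeProd n).coeff k := by
  have h := congrArg (fun p : ℂ[X] => p.coeff (k + 2)) (padeProd_ode n)
  simp only [coeff_sub, coeff_add, coeff_C_mul, coeff_X_mul, coeff_derivative,
    show k + 2 = k + 1 + 1 from rfl, pow_two, mul_assoc] at h
  have h4 : (X * derivative (padeProd n)).coeff k = k * (padeProd n).coeff k := by
    rcases k with _ | k
    · simp
    · rw [coeff_X_mul, coeff_derivative]; push_cast; ring
  rw [h4] at h
  push_cast at h ⊢
  linear_combination h

theorem padeProd_coeff_odd (n k : ℕ) : (padeProd n).coeff (2 * k + 1) = 0 := by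
  have h : (padeProd n).comp (-X) = padeProd n := by
    simp only [padeProd, padeDen, mul_comp, comp_assoc]
    simp [mul_comm]
  have h2 := congrArg (fun p : ℂ[X] => p.coeff (2 * k + 1)) h
  simp only [show (-X : ℂ[X]) = C (-1) * X by simp, comp_C_mul_X_coeff] at h2
  rw [pow_succ, pow_mul] at h2
  norm_num at h2
  have := neg_eq_iff_add_eq_zero.1 h2
  simpa using this

theorem padeProd_coeff_two {n : ℕ} (hn : 1 ≤ n) :
    (padeProd n).coeff 2 = -(1 / (4 * (2 * (n : ℂ) - 1))) := by
  have h := padeProd_coeff_rec n 0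
  rw [padeProd_coeff_zero] at h
  have h0 : (n : ℂ) ≠ 0 := by exact_mod_cast (by omega : n ≠ 0)
  have h1 : 2 * (n : ℂ) - 1 ≠ 0 := by
    intro h1
    have : ((2 * n : ℕ) : ℂ) = ((1 : ℕ) : ℂ) := by push_cast; linear_combination h1
    have := Nat.cast_injective this
    omega
  have h2 : (4 * (2 * (n : ℂ) - 1)) * (2 * n) * (padeProd n).coeff 2 = -(2 * n) := by
    push_cast at h
    simp only [zero_add] at h
    linear_combination h
  field_simp
  apply mul_right_cancel₀ h0
  linear_combination h2 / 2

/-- With n = j + 1 + m the recurrence gives the exact ratio -(2m+2) / ((2j+2)(2m+1)(2j+4+4m)). At j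
= 0 it is the sharper -1/(4(2n-1)), which is kept as the leading factor in the next bound. -/
theorem padeProd_coeff_step {n j : ℕ} (hj : j < n) :
    ‖(padeProd n).coeff (2 * (j + 1))‖ ≤ ‖(padeProd n).coeff (2 * j)‖ * (1 / (4 * n)) := by
  obtain ⟨m, rfl⟩ : ∃ m, n = j + 1 + m := ⟨n - j - 1, by omega⟩
  have h := padeProd_coeff_rec (j + 1 + m) (2 * j)
  set V := padeProd (j + 1 + m)
  have h1 : (((2 * j + 2) * (2 * m + 1) * (2 * j + 4 + 4 * m) : ℝ) : ℂ) * V.coeff (2 * (j + 1)) =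
      -((2 * m + 2 : ℝ) : ℂ) * V.coeff (2 * j) := by
    rw [show 2 * (j + 1) = 2 * j + 2 by ring]
    push_cast at h ⊢
    linear_combination h
  have h2 := congrArg norm h1
  rw [norm_mul, norm_mul, norm_neg, Complex.norm_real, Complex.norm_real,
    Real.norm_of_nonneg (by positivity), Real.norm_of_nonneg (by positivity)] at h2
  set a := ‖V.coeff (2 * (j + 1))‖
  set b := ‖V.coeff (2 * j)‖
  have hb : 0 ≤ b := norm_nonneg _
  have ha : 0 ≤ a := norm_nonneg _
  rw [mul_one_div, le_div_iff₀ (by positivity)]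
  have hpos : (0 : ℝ) < 2 * m + 2 := by positivity
  refine le_of_mul_le_mul_left ?_ hpos
  rw [← h2]
  have : (2 * m + 2) * (4 * ((j + 1 + m : ℕ) : ℝ)) ≤
      (2 * j + 2) * (2 * m + 1) * (2 * j + 4 + 4 * m) := by
    push_cast
    have : (0 : ℝ) ≤ m := by positivity
    have : (0 : ℝ) ≤ j := by positivity
    have : (0 : ℝ) ≤ j * m := by positivity
    have : (0 : ℝ) ≤ j * j * m := by positivity
    have : (0 : ℝ) ≤ j * j := by positivity
    have : (0 : ℝ) ≤ j * m * m := by positivity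
    nlinarith
  nlinarith

theorem padeProd_coeff_le {n j : ℕ} (hj : j < n) :
    ‖(padeProd n).coeff (2 * (j + 1))‖ ≤ 1 / (4 * (2 * (n : ℝ) - 1)) * (1 / (4 * n)) ^ j := by
  induction j with
  | zero =>
    have hn : (1 : ℝ) ≤ n := by exact_mod_cast hj
    rw [pow_zero, mul_one, show 2 * (0 + 1) = 2 from rfl, padeProd_coeff_two (by omega), norm_neg]
    rw [show (1 / (4 * (2 * (n : ℂ) - 1))) = ((1 / (4 * (2 * (n : ℝ) - 1)) : ℝ) : ℂ) by
      push_cast; ring, Complex.norm_real, Real.norm_of_nonneg]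
    apply div_nonneg zero_le_one; linarith
  | succ j ih =>
    refine (padeProd_coeff_step hj).trans ?_
    rw [pow_succ, ← mul_assoc]
    gcongr
    exact ih (by omega)

theorem sum_range_even_odd {M : Type*} [AddCommMonoid M] (F : ℕ → M) (n : ℕ) :
    ∑ k ∈ Finset.range (2 * n + 1), F k =
      F 0 + ∑ j ∈ Finset.range n, (F (2 * j + 1) + F (2 * (j + 1))) := by
  induction n with
  | zero => simp
  | succ n ih =>
    rw [Finset.sum_range_succ _ n, ← add_assoc, ← ih, show 2 * (n + 1) + 1 = 2 * n + 1 + 1 + 1 by ring,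
      Finset.sum_range_succ, Finset.sum_range_succ, add_assoc]
    rfl

theorem padeProd_eval (n : ℕ) (w : ℂ) : (padeProd n).eval w =
    1 + ∑ j ∈ Finset.range n, (padeProd n).coeff (2 * (j + 1)) * w ^ (2 * (j + 1)) := by
  rw [eval_eq_sum_range' (n := 2 * n + 1) (by have := padeProd_natDegree_le n; omega),
    sum_range_even_odd]
  simp [padeProd_coeff_zero, padeProd_coeff_odd]

/-- From degree four on, the terms are dominated by the modulus of the quadratic term times 1/2 +
1/4 + ⋯, because |w|²/(4n) ≤ 1/2. The tail is thus no larger than the quadratic term itself, which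
for real w gives exactly the upper bound 1. -/
theorem padeProd_eval_sub_le {n : ℕ} (hn : 13 ≤ n) {w : ℂ} (hw : ‖w‖ ^ 2 ≤ n + 1) :
    ‖(padeProd n).eval w - (1 - 1 / (4 * (2 * (n : ℂ) - 1)) * w ^ 2)‖ ≤
      1 / (4 * (2 * (n : ℝ) - 1)) * ‖w‖ ^ 2 := by
  obtain ⟨m, rfl⟩ : ∃ m, n = m + 1 := ⟨n - 1, by omega⟩
  rw [padeProd_eval, Finset.sum_range_succ']
  rw [show 2 * (0 + 1) = 2 from rfl, padeProd_coeff_two (by omega)]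
  set d : ℝ := 1 / (4 * (2 * ((m + 1 : ℕ) : ℝ) - 1)) with hd
  have hnR : (13 : ℝ) ≤ ((m + 1 : ℕ) : ℝ) := by exact_mod_cast hn
  have hd0 : 0 ≤ d := by
    apply div_nonneg zero_le_one; linarith
  set q : ℝ := ‖w‖ ^ 2 * (1 / (4 * ((m + 1 : ℕ) : ℝ))) with hq
  have hq0 : 0 ≤ q := by positivity
  have hq1 : q ≤ 1 / 2 := by
    rw [hq, mul_one_div, div_le_iff₀ (by positivity)]
    linarith
  have key : ‖∑ j ∈ Finset.range m, (padeProd (m + 1)).coeff (2 * (j + 1 + 1)) *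
      w ^ (2 * (j + 1 + 1))‖ ≤ d * ‖w‖ ^ 2 := by
    calc _ ≤ ∑ j ∈ Finset.range m, d * ‖w‖ ^ 2 * q ^ (j + 1) := by
          refine norm_sum_le_of_le _ fun j hj => ?_
          rw [norm_mul, norm_pow]
          calc _ ≤ d * (1 / (4 * ((m + 1 : ℕ) : ℝ))) ^ (j + 1) * ‖w‖ ^ (2 * (j + 1 + 1)) := by
                gcongr
                exact padeProd_coeff_le (by have := Finset.mem_range.1 hj; omega)
            _ = _ := by rw [hq, mul_pow, pow_mul, pow_succ (‖w‖ ^ 2) (j + 1)]; ring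
      _ ≤ ∑ j ∈ Finset.range m, d * ‖w‖ ^ 2 * (1 / 2) ^ (j + 1) := by gcongr
      _ = d * ‖w‖ ^ 2 * (1 - (1 / 2) ^ m) := by
          rw [← Finset.mul_sum]
          congr 1
          clear * -
          induction m with
          | zero => simp
          | succ m ih => rw [Finset.sum_range_succ, ih]; ring
      _ ≤ d * ‖w‖ ^ 2 * 1 := by
          gcongr
          have : (0 : ℝ) ≤ (1 / 2) ^ m := by positivity
          linarith
      _ = _ := mul_one _
  refine le_trans (le_of_eq ?_) key
  congr 1
  ring

theorem half_le_padeProd_eval {n : ℕ} (hn : 13 ≤ n) {w : ℂ} (hw : ‖w‖ ^ 2 ≤ n + 1) :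
    1 / 2 ≤ ‖(padeProd n).eval w‖ := by
  have h := padeProd_eval_sub_le hn hw
  have hnR : (13 : ℝ) ≤ n := by exact_mod_cast hn
  set d : ℝ := 1 / (4 * (2 * (n : ℝ) - 1)) with hd
  have hd0 : 0 ≤ d := by
    apply div_nonneg zero_le_one; linarith
  -- The quadratic term and the tail each cost at most 1/4, since n + 1 ≤ 2n - 1.
  have hdw : d * ‖w‖ ^ 2 ≤ 1 / 4 := by
    refine (mul_le_mul_of_nonneg_left hw hd0).trans ?_
    rw [hd, one_div_mul_eq_div, div_le_iff₀ (by linarith)]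
    linarith
  rw [show (1 / (4 * (2 * (n : ℂ) - 1))) = (d : ℂ) by rw [hd]; push_cast; ring] at h
  have h2 : ‖(1 : ℂ)‖ ≤ ‖(padeProd n).eval w‖ +
      ‖(padeProd n).eval w - (1 - (d : ℂ) * w ^ 2)‖ + ‖(d : ℂ) * w ^ 2‖ := by
    have e : (1 : ℂ) = (padeProd n).eval w -
      ((padeProd n).eval w - (1 - (d : ℂ) * w ^ 2)) + (d : ℂ) * w ^ 2 := by ring
    conv_lhs => rw [e]
    exact (norm_add_le _ _).trans (by gcongr; exact norm_sub_le _ _)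
  rw [norm_mul, norm_pow, Complex.norm_real, Real.norm_of_nonneg hd0, norm_one] at h2
  linarith

theorem padeProd_eval_ofReal_le {n : ℕ} (hn : 13 ≤ n) {s : ℝ} (hs : s ^ 2 ≤ n + 1) :
    ‖(padeProd n).eval (s : ℂ)‖ ≤ 1 := by
  have h := padeProd_eval_sub_le hn (w := (s : ℂ)) (by simpa using hs)
  have hnR : (13 : ℝ) ≤ n := by exact_mod_cast hn
  set d : ℝ := 1 / (4 * (2 * (n : ℝ) - 1)) with hd
  have hd0 : 0 ≤ d := by
    apply div_nonneg zero_le_one; linarith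
  have hdw : d * s ^ 2 ≤ 1 := by
    refine (mul_le_mul_of_nonneg_left hs hd0).trans ?_
    rw [hd, one_div_mul_eq_div, div_le_iff₀ (by linarith)]
    linarith
  rw [show 1 - (1 / (4 * (2 * (n : ℂ) - 1))) * (s : ℂ) ^ 2 = ((1 - d * s ^ 2 : ℝ) : ℂ) by
    rw [hd]; push_cast; ring] at h
  have h2 := norm_le_norm_add_norm_sub' ((padeProd n).eval (s : ℂ)) ((1 - d * s ^ 2 : ℝ) : ℂ)
  rw [Complex.norm_real (1 - d * s ^ 2), Real.norm_of_nonneg (by linarith)] at h2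
  simp only [Complex.norm_real, Real.norm_eq_abs, sq_abs] at h
  linarith

/-! ### Zeros of the Bessel polynomial and factorization of P -/

theorem besselPoly_coeff (n k : ℕ) : (besselPoly n).coeff k = if k ≤ n then
    (((n + k)! : ℕ) : ℂ) / ((((n - k)! : ℕ) : ℂ) * ((k ! : ℕ) : ℂ)) / 2 ^ k else 0 := by
  simp only [besselPoly, finsetSum_coeff, coeff_C_mul, coeff_X_pow]
  simp

theorem besselPoly_coeff_self_ne_zero (n : ℕ) : (besselPoly n).coeff n ≠ 0 := by
  rw [besselPoly_coeff, if_pos le_rfl]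
  have h1 := fun m : ℕ => (Nat.cast_ne_zero (R := ℂ)).2 m.factorial_ne_zero
  exact div_ne_zero (div_ne_zero (h1 _) (mul_ne_zero (h1 _) (h1 _))) (pow_ne_zero _ two_ne_zero)

theorem besselPoly_natDegree (n : ℕ) : (besselPoly n).natDegree = n := by
  refine natDegree_eq_of_le_of_coeff_ne_zero ?_ (besselPoly_coeff_self_ne_zero n)
  rw [natDegree_le_iff_coeff_eq_zero]
  intro k hk
  rw [besselPoly_coeff, if_neg (by omega)]

theorem besselPoly_card_roots (n : ℕ) : Multiset.card (besselPoly n).roots = n := by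
  rw [← (IsAlgClosed.splits (besselPoly n)).natDegree_eq_card_roots, besselPoly_natDegree]

/-- P is, up to scaling, the Bessel polynomial with its coefficients reversed; this is what turns
the zeros α into the factors 1 - αw/2. -/
theorem besselPoly_coeff_self_mul_padeNum_eval (n : ℕ) {w : ℂ} (hw : w ≠ 0) :
    (besselPoly n).coeff n * (padeNum n).eval w = (w / 2) ^ n * (besselPoly n).eval (2 / w) := by
  rw [eval_eq_sum_range' (p := padeNum n) (n := n + 1) (by have := padeNum_natDegree_le n; omega),
    eval_eq_sum_range' (p := besselPoly n) (n := n + 1) (by rw [besselPoly_natDegree]; omega),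
    ← Finset.sum_range_reflect, Finset.mul_sum, Finset.mul_sum]
  refine Finset.sum_congr rfl fun k hk => ?_
  have hk : k ≤ n := Nat.lt_succ_iff.1 (Finset.mem_range.1 hk)
  obtain ⟨m, rfl⟩ := Nat.exists_eq_add_of_le hk
  rw [besselPoly_coeff, besselPoly_coeff, padeNum_coeff, if_pos (by omega), if_pos (by omega),
    if_pos (by omega)]
  have e1 : k + m + 1 - 1 - k = m := by omega
  have e2 : 2 * (k + m) - m = k + m + k := by omega
  have e3 : k + m - m = k := by omega
  have e4 : k + m - k = m := by omega
  rw [e1, e2, e3, e4, Nat.sub_self, show k + m + (k + m) = 2 * (k + m) by ring]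
  have h1 := fun m : ℕ => (Nat.cast_ne_zero (R := ℂ)).2 m.factorial_ne_zero
  have := h1 (2 * (k + m))
  have := h1 (k + m)
  have := h1 k
  have := h1 m
  rw [div_pow, div_pow, pow_add, pow_add]
  simp
  field_simp

theorem padeNum_eval_eq_prod (n : ℕ) (w : ℂ) :
    (padeNum n).eval w = ((besselPoly n).roots.map fun α => 1 - α / 2 * w).prod := by
  rcases eq_or_ne w 0 with rfl | hw
  · simp [← coeff_zero_eq_eval_zero, padeNum_coeff_zero]
  · apply mul_left_cancel₀ (besselPoly_coeff_self_ne_zero n)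
    rw [besselPoly_coeff_self_mul_padeNum_eval n hw,
      (IsAlgClosed.splits (besselPoly n)).eval_eq_prod_roots, leadingCoeff, besselPoly_natDegree,
      mul_left_comm]
    congr 1
    nth_rw 1 [← besselPoly_card_roots n]
    rw [← Multiset.prod_replicate, ← Multiset.map_const', ← Multiset.prod_map_mul]
    congr 1
    refine Multiset.map_congr rfl fun α _ => ?_
    field_simp

theorem one_sub_ne_zero_of_padeProd {n : ℕ} {w : ℂ} (h : (padeProd n).eval w ≠ 0) :
    ∀ α ∈ (besselPoly n).roots, 1 - α / 2 * w ≠ 0 ∧ 1 + α / 2 * w ≠ 0 := by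
  intro α hα
  rw [padeProd, eval_mul, padeDen_eval, padeNum_eval_eq_prod, padeNum_eval_eq_prod] at h
  refine ⟨fun h0 => h ?_, fun h0 => h ?_⟩
  · rw [Multiset.prod_eq_zero (Multiset.mem_map.2 ⟨α, hα, h0⟩), zero_mul]
  · rw [Multiset.prod_eq_zero (s := Multiset.map (fun α => 1 - α / 2 * -w) _)
      (Multiset.mem_map.2 ⟨α, hα, by rw [← h0]; ring⟩), mul_zero]

theorem hasDerivAt_multiset_prod_one_sub (s : Multiset ℂ) {w : ℂ}
    (h : ∀ α ∈ s, 1 - α / 2 * w ≠ 0) :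
    HasDerivAt (fun w => (s.map fun α => 1 - α / 2 * w).prod)
      ((s.map fun α => 1 - α / 2 * w).prod * (s.map fun α => -(α / 2) / (1 - α / 2 * w)).sum) w := by
  induction s using Multiset.induction with
  | empty => simpa using hasDerivAt_const w (1 : ℂ)
  | cons a s ih =>
    have h1 := ih fun α hα => h α (Multiset.mem_cons_of_mem hα)
    have h2 : HasDerivAt (fun w : ℂ => 1 - a / 2 * w) (-(a / 2)) w := by
      simpa using ((hasDerivAt_id w).const_mul (a / 2)).const_sub 1
    have h0 := h a (Multiset.mem_cons_self a s)
    simp only [Multiset.map_cons, Multiset.prod_cons, Multiset.sum_cons]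
    convert! h2.mul h1 using 1
    rw [mul_add, mul_right_comm _ _ (-(a / 2) / _), mul_div_cancel₀ _ h0, mul_assoc]

theorem padeNum_derivative_eval {n : ℕ} {w : ℂ}
    (h : ∀ α ∈ (besselPoly n).roots, 1 - α / 2 * w ≠ 0) :
    (derivative (padeNum n)).eval w = (padeNum n).eval w *
      ((besselPoly n).roots.map fun α => -(α / 2) / (1 - α / 2 * w)).sum := by
  have h1 := (padeNum n).hasDerivAt w
  have h2 := hasDerivAt_multiset_prod_one_sub _ h
  simp only [← padeNum_eval_eq_prod] at h2
  exact h1.unique h2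

/-! ### The remainder of the geometric series -/

/-- Closed form of the remainder for the geometric series. -/
theorem diffRemainder_geometric {n : ℕ} (hn : 1 ≤ n) {z : ℂ} (hz : z ≠ 1)
    (hV : (padeProd n).eval (z / (1 - z)) ≠ 0) :
    diffRemainder n (fun z => (1 - z)⁻¹) z = (-1) ^ n * (gammaCoeff n : ℂ) * z ^ (2 * n + 1) *
      ((1 - z) ^ (2 * n + 2) * (padeProd n).eval (z / (1 - z)))⁻¹ := by
  have hz1 : 1 - z ≠ 0 := sub_ne_zero.2 hz.symm
  set w := z / (1 - z) with hw
  have hroots := one_sub_ne_zero_of_padeProd hV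
  have hderiv : deriv (fun z : ℂ => (1 - z)⁻¹) z = ((1 - z) ^ 2)⁻¹ := by
    have h1 : HasDerivAt (fun z : ℂ => 1 - z) (-1) z := by
      simpa using (hasDerivAt_id z).const_sub 1
    rw [(h1.fun_inv hz1).deriv]
    simp
  have hD1 := padeNum_derivative_eval (fun α hα => (hroots α hα).1)
  have hD2 := padeNum_derivative_eval (n := n) (w := -w) (fun α hα => by
    rw [mul_neg, sub_neg_eq_add]; exact (hroots α hα).2)
  set L₁ := ((besselPoly n).roots.map fun α => -(α / 2) / (1 - α / 2 * w)).sum with hL₁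
  set L₂ := ((besselPoly n).roots.map fun α => -(α / 2) / (1 - α / 2 * -w)).sum with hL₂
  -- L₁ is P'/P at w and L₂ is P'/P at -w, that is, -Q'/Q at w.
  have hsum : diffSum n (fun z => (1 - z)⁻¹) z = w / (1 - z) * (L₁ + L₂) := by
    rw [hL₁, hL₂, ← Multiset.sum_map_add, ← Multiset.sum_map_mul_left, diffSum]
    congr 1
    refine Multiset.map_congr rfl fun α hα => ?_
    obtain ⟨h1, h2⟩ := hroots α hα
    have e1 : 1 - (1 - α / 2) * z = (1 - z) * (1 + α / 2 * w) := by rw [hw]; field_simp; ring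
    have e2 : 1 - (1 + α / 2) * z = (1 - z) * (1 - α / 2 * w) := by rw [hw]; field_simp; ring
    rw [e1, e2, mul_neg, sub_neg_eq_add]
    generalize α / 2 = β at h1 h2
    field_simp
    ring
  have hN := congrArg (eval w) (padeWronskian_eq hn)
  simp only [padeWronskian, eval_sub, eval_add, eval_mul, eval_C, eval_pow, eval_X,
    padeDen_derivative_eval, hD1, hD2] at hN
  rw [padeDen_eval] at hN
  have hVe : (padeProd n).eval w = (padeNum n).eval w * (padeNum n).eval (-w) := by
    rw [padeProd, eval_mul, padeDen_eval]
  have hN' : (padeProd n).eval w * (1 - L₁ - L₂) = (-1) ^ n * (gammaCoeff n : ℂ) * w ^ (2 * n) := by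
    rw [hVe, ← hN]; ring
  rw [diffRemainder, hsum, hderiv]
  have hzw : z = w * (1 - z) := by rw [hw]; field_simp
  have : z * ((1 - z) ^ 2)⁻¹ - w / (1 - z) * (L₁ + L₂) =
      w / (1 - z) * ((padeProd n).eval w * (1 - L₁ - L₂)) / (padeProd n).eval w := by
    nth_rw 1 [hzw]
    field_simp
    ring
  rw [this, hN']
  have hzp : z ^ (2 * n + 1) = w ^ (2 * n + 1) * (1 - z) ^ (2 * n + 1) := by
    rw [← mul_pow, ← hzw]
  rw [hzp, pow_succ (1 - z) (2 * n + 1), pow_succ w]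
  field_simp

theorem norm_div_one_sub_sq_le {n : ℕ} {x : ℝ} (hx1 : x < 1)
    (hxn : x ^ 2 / (1 - x) ^ 2 ≤ n + 1) {z : ℂ} (hz : ‖z‖ ≤ x) : ‖z / (1 - z)‖ ^ 2 ≤ n + 1 := by
  refine le_trans ?_ hxn
  have h1 : 1 - x ≤ ‖1 - z‖ := by
    have := norm_sub_norm_le 1 z
    rw [norm_one] at this
    linarith
  have h2 : 0 < 1 - x := by linarith
  rw [norm_div, div_pow]
  gcongr

/-- The point w = 2/α is a zero of V, so it must lie outside the disk |w| ≤ x/(1-x), where |V| ≥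
1/2. Hence |α/2| x < 1 - x, and the triangle inequality finishes. -/
theorem norm_besselRoot_mul_lt {n : ℕ} (hn : 13 ≤ n) {x : ℝ} (hx0 : 0 < x) (hx1 : x < 1)
    (hxn : x ^ 2 / (1 - x) ^ 2 ≤ n + 1) {α : ℂ} (hα : α ∈ (besselPoly n).roots) :
    ‖1 - α / 2‖ * x < 1 ∧ ‖1 + α / 2‖ * x < 1 := by
  have key : ‖α / 2‖ * x < 1 - x := by
    by_contra! hcon
    have h0 : 0 < ‖α / 2‖ := by
      by_contra! h
      nlinarith
    have hα0 : α / 2 ≠ 0 := norm_pos_iff.1 h0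
    have hw : ‖(α / 2)⁻¹‖ ^ 2 ≤ (n : ℝ) + 1 := by
      refine le_trans ?_ hxn
      rw [← div_pow, norm_inv]
      gcongr
      rw [inv_le_comm₀ h0 (by apply div_pos hx0; linarith), inv_div, div_le_iff₀ hx0]
      exact hcon
    have hV := half_le_padeProd_eval hn hw
    refine (one_sub_ne_zero_of_padeProd (n := n) (w := (α / 2)⁻¹) ?_ α hα).1 ?_
    · intro h
      rw [h, norm_zero] at hV
      norm_num at hV
    · rw [mul_inv_cancel₀ hα0, sub_self]
  have h1 := norm_sub_le 1 (α / 2)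
  have h2 := norm_add_le 1 (α / 2)
  rw [norm_one] at h1 h2
  constructor <;> nlinarith

/-! ### Termwise action on power series and the upper bound -/

/-- The factor by which the remainder functional multiplies `z ^ m`. -/
noncomputable def remainderCoeff (n m : ℕ) : ℂ :=
  m - ((besselPoly n).roots.map fun α => (1 - α / 2) ^ m - (1 + α / 2) ^ m).sum

theorem hasSum_multiset_sum {ι : Type*} (s : Multiset ℂ) {F : ℂ → ι → ℂ} {a : ℂ → ℂ}
    (h : ∀ α ∈ s, HasSum (F α) (a α)) :
    HasSum (fun i => (s.map fun α => F α i).sum) (s.map a).sum := by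
  induction s using Multiset.induction with
  | empty => simp
  | cons b s ih =>
    simp only [Multiset.map_cons, Multiset.sum_cons]
    exact (h b (Multiset.mem_cons_self b s)).add
      (ih fun α hα => h α (Multiset.mem_cons_of_mem hα))

theorem hasSum_mul_deriv {f : ℂ → ℂ} {c : ℕ → ℂ} (hc : ∀ m, ‖c m‖ ≤ 1)
    (hf : ∀ z : ℂ, ‖z‖ < 1 → HasSum (fun m : ℕ => c m * z ^ m) (f z)) {z : ℂ} (hz : ‖z‖ < 1) :
    HasSum (fun m : ℕ => c m * m * z ^ m) (z * deriv f z) := by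
  -- On the disk of radius r < 1 the series is dominated by ∑ r^m, which justifies termwise
  -- differentiation.
  obtain ⟨r, hzr, hr1⟩ := exists_between hz
  have hr0 : 0 ≤ r := (norm_nonneg z).trans hzr.le
  have h := Complex.hasSum_deriv_of_summable_norm (U := Metric.ball (0 : ℂ) r)
    (F := fun (m : ℕ) (w : ℂ) => c m * w ^ m) (summable_geometric_of_lt_one hr0 hr1)
    (fun m => by fun_prop) Metric.isOpen_ball (fun m w hw => by
      have hw : ‖w‖ ≤ r := (mem_ball_zero_iff.1 hw).le
      rw [norm_mul, norm_pow]
      calc _ ≤ 1 * r ^ m := by gcongr; exact hc m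
        _ = _ := one_mul _) (z := z) (mem_ball_zero_iff.2 hzr)
  have heq : deriv (fun w : ℂ => ∑' m : ℕ, c m * w ^ m) z = deriv f z := by
    apply Filter.EventuallyEq.deriv_eq
    filter_upwards [Metric.isOpen_ball.mem_nhds (mem_ball_zero_iff.2 hz)] with w hw
    exact (hf w (mem_ball_zero_iff.1 hw)).tsum_eq
  rw [heq] at h
  convert! h.mul_left z using 1
  ext m
  rw [deriv_const_mul_field, deriv_pow_field]
  rcases m with _ | m
  · simp
  · simp [pow_succ]; ring

theorem hasSum_diffRemainder {n : ℕ} {f : ℂ → ℂ} {c : ℕ → ℂ} (hc : ∀ m, ‖c m‖ ≤ 1)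
    (hf : ∀ z : ℂ, ‖z‖ < 1 → HasSum (fun m : ℕ => c m * z ^ m) (f z)) {z : ℂ} (hz : ‖z‖ < 1)
    (ha : ∀ α ∈ (besselPoly n).roots, ‖(1 - α / 2) * z‖ < 1 ∧ ‖(1 + α / 2) * z‖ < 1) :
    HasSum (fun m : ℕ => c m * remainderCoeff n m * z ^ m) (diffRemainder n f z) := by
  have h1 := hasSum_mul_deriv hc hf hz
  have h2 := hasSum_multiset_sum (besselPoly n).roots fun α hα =>
    (hf _ (ha α hα).1).sub (hf _ (ha α hα).2)
  refine (h1.sub h2).congr_fun ?_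
  intro m
  rw [remainderCoeff]
  have : ((besselPoly n).roots.map fun α =>
      c m * ((1 - α / 2) * z) ^ m - c m * ((1 + α / 2) * z) ^ m).sum =
      c m * z ^ m * ((besselPoly n).roots.map fun α => (1 - α / 2) ^ m - (1 + α / 2) ^ m).sum := by
    rw [← Multiset.sum_map_mul_left]
    congr 1
    refine Multiset.map_congr rfl fun α _ => ?_
    rw [mul_pow, mul_pow]; ring
  rw [this]
  ring

theorem hasSum_pow_unique {a b : ℕ → ℂ} {F : ℂ → ℂ} {r : ℝ} (hr : 0 < r)
    (ha : ∀ z : ℂ, ‖z‖ < r → HasSum (fun m => a m * z ^ m) (F z))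
    (hb : ∀ z : ℂ, ‖z‖ < r → HasSum (fun m => b m * z ^ m) (F z)) : a = b := by
  have key : ∀ a : ℕ → ℂ, (∀ z : ℂ, ‖z‖ < r → HasSum (fun m => a m * z ^ m) (F z)) →
      HasFPowerSeriesAt F (FormalMultilinearSeries.ofScalars ℂ a) 0 := by
    intro a ha
    rw [hasFPowerSeriesAt_iff]
    filter_upwards [Metric.isOpen_ball.mem_nhds (Metric.mem_ball_self (x := (0 : ℂ)) hr)] with z hz
    simpa [FormalMultilinearSeries.coeff_ofScalars, mul_comm] using ha z (mem_ball_zero_iff.1 hz)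
  have h := (key a ha).eq_formalMultilinearSeries (key b hb)
  ext m
  simpa [FormalMultilinearSeries.coeff_ofScalars] using congrArg (fun p => p.coeff m) h

theorem hasSum_one_mul_pow {z : ℂ} (hz : ‖z‖ < 1) :
    HasSum (fun m : ℕ => (1 : ℂ) * z ^ m) ((1 - z)⁻¹) := by
  simpa using hasSum_geometric_of_norm_lt_one hz

theorem norm_mul_lt_of_mul_lt {a z : ℂ} {x : ℝ} (h : ‖a‖ * x < 1) (hz : ‖z‖ ≤ x) :
    ‖a * z‖ < 1 := by
  rw [norm_mul]
  exact (mul_le_mul_of_nonneg_left hz (norm_nonneg a)).trans_lt h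

theorem padeProd_eval_ne_zero {n : ℕ} (hn : 13 ≤ n) {w : ℂ} (hw : ‖w‖ ^ 2 ≤ n + 1) :
    (padeProd n).eval w ≠ 0 := by
  have := half_le_padeProd_eval hn hw
  exact norm_pos_iff.1 (by linarith)

/-- The remainder of the geometric series has two expansions on |z| < x: the termwise one, and the
closed form κ z^(2n+1) g(z) with g holomorphic on |z| ≤ x. Uniqueness identifies the coefficients,
and Cauchy's estimate for g on |z| = x bounds them. -/
theorem remainderCoeff_bound {n : ℕ} (hn : 13 ≤ n) {x : ℝ} (hx0 : 0 < x) (hx1 : x < 1)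
    (hxn : x ^ 2 / (1 - x) ^ 2 ≤ n + 1) :
    (∀ m < 2 * n + 1, remainderCoeff n m = 0) ∧ ∀ j, ‖remainderCoeff n (j + (2 * n + 1))‖ ≤
      gammaCoeff n * (2 / (1 - x) ^ (2 * n + 2)) / x ^ j := by
  have hx1' : 0 < 1 - x := by linarith
  have hγ : 0 ≤ gammaCoeff n := by unfold gammaCoeff; positivity
  set g : ℂ → ℂ := fun z => ((1 - z) ^ (2 * n + 2) * (padeProd n).eval (z / (1 - z)))⁻¹ with hg
  have hz1 : ∀ z : ℂ, ‖z‖ ≤ x → z ≠ 1 := by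
    rintro z hz rfl
    rw [norm_one] at hz
    linarith
  have hV : ∀ z : ℂ, ‖z‖ ≤ x → (padeProd n).eval (z / (1 - z)) ≠ 0 := fun z hz =>
    padeProd_eval_ne_zero hn (norm_div_one_sub_sq_le hx1 hxn hz)
  have hgd : DifferentiableOn ℂ g (Metric.closedBall 0 x) := by
    intro z hz
    have hz := mem_closedBall_zero_iff.1 hz
    have h1 : 1 - z ≠ 0 := sub_ne_zero.2 (hz1 z hz).symm
    apply DifferentiableAt.differentiableWithinAt
    refine DifferentiableAt.inv ?_ (mul_ne_zero (pow_ne_zero _ h1) (hV z hz))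
    refine DifferentiableAt.mul (by fun_prop) ?_
    exact (padeProd n).differentiable.differentiableAt.comp z
      (DifferentiableAt.div (by fun_prop) (by fun_prop) h1)
  have hgb : ∀ z : ℂ, ‖z‖ ≤ x → ‖g z‖ ≤ 2 / (1 - x) ^ (2 * n + 2) := by
    intro z hz
    have h1 : 1 - x ≤ ‖1 - z‖ := by
      have := norm_sub_norm_le 1 z
      rw [norm_one] at this
      linarith
    have h2 := half_le_padeProd_eval hn (norm_div_one_sub_sq_le hx1 hxn hz)
    rw [hg, norm_inv, norm_mul, norm_pow,
      show 2 / (1 - x) ^ (2 * n + 2) = ((1 - x) ^ (2 * n + 2) * (1 / 2))⁻¹ by field_simp]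
    gcongr
  set d : ℕ → ℂ := fun j => (j ! : ℂ)⁻¹ * iteratedDeriv j g 0 with hd
  have hdb : ∀ j, ‖d j‖ ≤ 2 / (1 - x) ^ (2 * n + 2) / x ^ j := by
    intro j
    have h := Complex.norm_iteratedDeriv_le_of_forall_mem_sphere_norm_le j hx0
      (hgd.diffContOnCl_ball subset_rfl) (fun z hz => hgb z (mem_sphere_zero_iff_norm.1 hz).le)
    have hj : (0 : ℝ) < j ! := by exact_mod_cast j.factorial_pos
    rw [hd, norm_mul, norm_inv, Complex.norm_natCast, inv_mul_le_iff₀ hj, ← mul_div_assoc]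
    exact h
  set κ : ℂ := (-1) ^ n * (gammaCoeff n : ℂ) with hκ
  have hκn : ‖κ‖ = gammaCoeff n := by
    rw [hκ, norm_mul, norm_pow, norm_neg, norm_one, one_pow, one_mul, Complex.norm_real,
      Real.norm_of_nonneg hγ]
  set b : ℕ → ℂ := fun m => if m < 2 * n + 1 then 0 else κ * d (m - (2 * n + 1)) with hb
  have hbsum : ∀ z : ℂ, ‖z‖ < x →
      HasSum (fun m => b m * z ^ m) (diffRemainder n (fun z => (1 - z)⁻¹) z) := by
    intro z hz
    rw [diffRemainder_geometric (by omega) (hz1 z hz.le) (hV z hz.le), ← hκ]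
    have h1 := Complex.hasSum_taylorSeries_on_ball (hgd.mono Metric.ball_subset_closedBall)
      (mem_ball_zero_iff.2 hz)
    have h2 := h1.mul_left (κ * z ^ (2 * n + 1))
    refine (Function.Injective.hasSum_iff (add_left_injective (2 * n + 1)) ?_).1 ?_
    · intro m hm
      have : m < 2 * n + 1 := by
        by_contra! h
        exact hm ⟨m - (2 * n + 1), Nat.sub_add_cancel h⟩
      simp only [hb, if_pos this, zero_mul]
    · refine h2.congr_fun ?_
      intro j
      simp only [hb, hd, Function.comp, smul_eq_mul, sub_zero, add_tsub_cancel_right,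
        if_neg (show ¬ j + (2 * n + 1) < 2 * n + 1 by omega), pow_add z j]
      ring
  have hasum : ∀ z : ℂ, ‖z‖ < x →
      HasSum (fun m => remainderCoeff n m * z ^ m) (diffRemainder n (fun z => (1 - z)⁻¹) z) := by
    intro z hz
    have := hasSum_diffRemainder (n := n) (f := fun z => (1 - z)⁻¹) (c := fun _ => 1)
      (fun _ => by simp) (fun z hz => hasSum_one_mul_pow hz) (hz.trans hx1)
      (fun α hα => by
        have h := norm_besselRoot_mul_lt hn hx0 hx1 hxn hα
        exact ⟨norm_mul_lt_of_mul_lt h.1 hz.le, norm_mul_lt_of_mul_lt h.2 hz.le⟩)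
    simpa using this
  have hρ := hasSum_pow_unique hx0 hasum hbsum
  refine ⟨fun m hm => by rw [hρ, hb]; simp [hm], fun j => ?_⟩
  rw [hρ, hb]
  simp only [if_neg (show ¬ j + (2 * n + 1) < 2 * n + 1 by omega), add_tsub_cancel_right]
  rw [norm_mul, hκn, mul_div_assoc]
  exact mul_le_mul_of_nonneg_left (hdb j) hγ

theorem norm_diffRemainder_le {f : ℂ → ℂ} (hf : HasUnitTaylorCoeffs f) {n : ℕ} (hn : 13 ≤ n)
    {x : ℝ} (hx0 : 0 < x) (hx1 : x < 1) (hxn : x ^ 2 / (1 - x) ^ 2 ≤ n + 1)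
    {z : ℂ} (hz : ‖z‖ < x) : ‖diffRemainder n f z‖ ≤ remainderBound n x ‖z‖ := by
  obtain ⟨c, hc, hcf⟩ := hf
  have hx1' : 0 < 1 - x := by linarith
  obtain ⟨hzero, hbd⟩ := remainderCoeff_bound hn hx0 hx1 hxn
  have h := hasSum_diffRemainder (n := n) hc hcf (hz.trans hx1) (fun α hα => by
    have h := norm_besselRoot_mul_lt hn hx0 hx1 hxn hα
    exact ⟨norm_mul_lt_of_mul_lt h.1 hz.le, norm_mul_lt_of_mul_lt h.2 hz.le⟩)
  -- Drop the vanishing terms m ≤ 2n; the rest is dominated by a geometric series of ratio |z|/x,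
  -- the source of the factor 1/(x - |z|).
  rw [← Function.Injective.hasSum_iff (add_left_injective (2 * n + 1)) (fun m hm => by
    have : m < 2 * n + 1 := by
      by_contra! h
      exact hm ⟨m - (2 * n + 1), Nat.sub_add_cancel h⟩
    rw [hzero m this]; ring)] at h
  have hq : ‖z‖ / x < 1 := (div_lt_one hx0).2 hz
  have hgeo := (hasSum_geometric_of_lt_one (by positivity) hq).mul_left
    (‖z‖ ^ (2 * n + 1) * (gammaCoeff n * (2 / (1 - x) ^ (2 * n + 2))))
  have hxz : 0 < x - ‖z‖ := by linarith
  have e : ‖z‖ ^ (2 * n + 1) * (gammaCoeff n * (2 / (1 - x) ^ (2 * n + 2))) * (1 - ‖z‖ / x)⁻¹ =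
      remainderBound n x ‖z‖ := by
    rw [remainderBound]
    field_simp
  rw [e] at hgeo
  rw [← h.tsum_eq]
  refine tsum_of_norm_bounded hgeo fun j => ?_
  simp only [Function.comp]
  rw [norm_mul, norm_mul, norm_pow]
  calc _ ≤ 1 * (gammaCoeff n * (2 / (1 - x) ^ (2 * n + 2)) / x ^ j) * ‖z‖ ^ (j + (2 * n + 1)) := by
        gcongr
        · exact hc _
        · exact hbd j
    _ = _ := by rw [div_pow, pow_add ‖z‖ j]; ring

/-! ### Sharpness -/

theorem diffRemainder_comp_mul (n : ℕ) (f : ℂ → ℂ) (v z : ℂ) :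
    diffRemainder n (fun z => f (v * z)) z = diffRemainder n f (v * z) := by
  have h := deriv_comp_mul_left v f z
  rw [diffRemainder, diffRemainder, h, diffSum, diffSum, smul_eq_mul]
  simp only [mul_left_comm v]
  ring

theorem le_norm_diffRemainder_geometric {n : ℕ} (hn : 13 ≤ n)
    {x : ℝ} (hx1 : x < 1) (hxn : x ^ 2 / (1 - x) ^ 2 ≤ n + 1) {t : ℝ} (ht0 : 0 ≤ t) (htx : t ≤ x) :
    t ^ (2 * n + 1) / (1 - t) ^ (2 * n + 2) * gammaCoeff n ≤
      ‖diffRemainder n (fun z => (1 - z)⁻¹) (t : ℂ)‖ := by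
  have hγ : 0 ≤ gammaCoeff n := by unfold gammaCoeff; positivity
  have ht : ‖(t : ℂ)‖ ≤ x := by rw [Complex.norm_real, Real.norm_of_nonneg ht0]; exact htx
  have hw := norm_div_one_sub_sq_le hx1 hxn ht
  have ht1 : 0 < 1 - t := by linarith
  have hV := padeProd_eval_ne_zero hn hw
  rw [diffRemainder_geometric (by omega) (by exact_mod_cast (by linarith : t ≠ 1)) hV]
  have e : (t : ℂ) / (1 - t) = ((t / (1 - t) : ℝ) : ℂ) := by push_cast; rfl
  rw [e] at hw hV ⊢
  rw [Complex.norm_real, Real.norm_eq_abs, sq_abs] at hw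
  have hV1 := padeProd_eval_ofReal_le hn hw
  have hV0 := norm_pos_iff.2 hV
  have e2 : (1 - (t : ℂ)) = ((1 - t : ℝ) : ℂ) := by push_cast; rfl
  rw [e2, norm_mul, norm_mul, norm_mul, norm_inv, norm_mul, norm_pow, norm_pow, norm_pow,
    Complex.norm_real, Complex.norm_real, Complex.norm_real, Real.norm_of_nonneg ht0,
    Real.norm_of_nonneg ht1.le, Real.norm_of_nonneg hγ, norm_neg, norm_one, one_pow, one_mul]
  have h3 : ((1 - t) ^ (2 * n + 2))⁻¹ ≤
      ((1 - t) ^ (2 * n + 2) * ‖(padeProd n).eval ((t / (1 - t) : ℝ) : ℂ)‖)⁻¹ := by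
    apply inv_anti₀ (by positivity)
    exact mul_le_of_le_one_right (by positivity) hV1
  calc _ = gammaCoeff n * t ^ (2 * n + 1) * ((1 - t) ^ (2 * n + 2))⁻¹ := by
        rw [div_eq_mul_inv]; ring
    _ ≤ _ := by gcongr

theorem exp_neg_two_mul_remainderBound_le {n : ℕ} {x t : ℝ} (hx0 : 0 < x) (hx1 : x < 1)
    (ht0 : 0 ≤ t) (htx : t < x) (h : x - t ≤ (1 - x) / ((n : ℝ) + 1)) :
    Real.exp (-2) * ((x - t) / (2 * x)) * remainderBound n x t ≤
      t ^ (2 * n + 1) / (1 - t) ^ (2 * n + 2) * gammaCoeff n := by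
  have hγ : 0 ≤ gammaCoeff n := by unfold gammaCoeff; positivity
  have h1 : 0 < 1 - x := by linarith
  have h2 : 0 < 1 - t := by linarith
  have h3 : 0 < x - t := by linarith
  have e : Real.exp (-2) * ((x - t) / (2 * x)) * remainderBound n x t =
      t ^ (2 * n + 1) * (Real.exp (-2) / (1 - x) ^ (2 * n + 2)) * gammaCoeff n := by
    rw [remainderBound]; field_simp
  rw [e, div_eq_mul_one_div (t ^ (2 * n + 1))]
  refine mul_le_mul_of_nonneg_right (mul_le_mul_of_nonneg_left ?_ (by positivity)) hγ
  rw [div_le_div_iff₀ (by positivity) (by positivity), Real.exp_neg, one_mul,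
    inv_mul_le_iff₀ (Real.exp_pos _)]
  -- Closeness of t to x gives 1 - t ≤ (1 + 1/(n+1))(1 - x); the power 2n + 2 turns the exponential
  -- factor into e².
  have h4 : 1 - t ≤ Real.exp (1 / ((n : ℝ) + 1)) * (1 - x) := by
    have h5 := Real.add_one_le_exp (1 / ((n : ℝ) + 1))
    calc 1 - t ≤ (1 / ((n : ℝ) + 1) + 1) * (1 - x) := by
          rw [add_mul, one_div_mul_eq_div]; linarith
      _ ≤ _ := by gcongr
  calc (1 - t) ^ (2 * n + 2) ≤ (Real.exp (1 / ((n : ℝ) + 1)) * (1 - x)) ^ (2 * n + 2) := by gcongr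
    _ = _ := by
      rw [mul_pow, ← Real.exp_nat_mul]
      congr 2
      push_cast
      field_simp

/-! ### Stirling estimate and the case x = x_n -/

/-- The Stirling sequence decreases from e/√2 and stays at least √π, so the constant left over is at
most e²/(4π) < 1. -/
theorem gammaCoeff_le {n : ℕ} (hn : n ≠ 0) :
    gammaCoeff n ≤ (Real.exp 1 / (4 * n)) ^ (2 * n) := by
  have hn0 : (0 : ℝ) < n := by positivity
  have h1 : Stirling.stirlingSeq n ≤ Real.exp 1 / √2 := by
    rw [← Stirling.stirlingSeq_one]
    have := Stirling.stirlingSeq'_antitone (Nat.zero_le (n - 1))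
    simpa [Nat.sub_add_cancel (Nat.one_le_iff_ne_zero.2 hn)] using this
  have h2 := Stirling.sqrt_pi_le_stirlingSeq (n := 2 * n) (by omega)
  set E := Real.exp 1 with hE
  have hE0 : 0 < E := Real.exp_pos 1
  have f1 : (n ! : ℝ) ^ 2 = Stirling.stirlingSeq n ^ 2 * (2 * n) * (n / E) ^ (2 * n) := by
    rw [Stirling.stirlingSeq, div_pow, mul_pow, Real.sq_sqrt (by positivity), ← pow_mul,
      mul_comm n 2, ← hE]
    field_simp
  have f2 : ((2 * n)! : ℝ) ^ 2 =
      Stirling.stirlingSeq (2 * n) ^ 2 * (4 * n) * (2 * n / E) ^ (4 * n) := by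
    rw [Stirling.stirlingSeq, div_pow, mul_pow, Real.sq_sqrt (by positivity), ← pow_mul,
      show 2 * n * 2 = 4 * n by ring, ← hE]
    push_cast
    field_simp
    ring
  have g1 : Stirling.stirlingSeq n ^ 2 ≤ E ^ 2 / 2 := by
    have h0 : 0 ≤ Stirling.stirlingSeq n := by unfold Stirling.stirlingSeq; positivity
    calc _ ≤ (E / √2) ^ 2 := by gcongr
      _ = _ := by rw [div_pow, Real.sq_sqrt (by norm_num)]
  have g2 : Real.pi ≤ Stirling.stirlingSeq (2 * n) ^ 2 := by
    calc _ = (√Real.pi) ^ 2 := (Real.sq_sqrt Real.pi_pos.le).symm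
      _ ≤ _ := by gcongr
  have hE2 : E ^ 2 / 2 * 2 ≤ Real.pi * 4 := by
    have := Real.exp_one_lt_three
    have := Real.pi_gt_three
    nlinarith
  rw [gammaCoeff, f1, f2, div_le_iff₀ (by
    have := Real.pi_pos.trans_le g2
    positivity)]
  have e : (E / (4 * n)) ^ (2 * n) * (2 * n / E) ^ (4 * n) = (n / E) ^ (2 * n) := by
    rw [show 4 * n = 2 * (2 * n) by ring, pow_mul _ 2 (2 * n), ← mul_pow]
    congr 1
    field_simp
    ring
  calc _ ≤ E ^ 2 / 2 * (2 * n) * (n / E) ^ (2 * n) := by gcongr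
    _ = (E ^ 2 / 2 * 2) * n * (n / E) ^ (2 * n) := by ring
    _ ≤ Real.pi * 4 * n * (n / E) ^ (2 * n) := by gcongr
    _ ≤ Stirling.stirlingSeq (2 * n) ^ 2 * 4 * n * (n / E) ^ (2 * n) := by gcongr
    _ = _ := by rw [← e]; ring

theorem remainderBound_sqrt_le {n : ℕ} (hn : 13 ≤ n) {t : ℝ} (ht0 : 0 ≤ t)
    (ht : t < √(n : ℝ) / (1 + √(n : ℝ))) :
    remainderBound n (√(n : ℝ) / (1 + √(n : ℝ))) t ≤
      t ^ (2 * n + 1) / (√(n : ℝ) / (1 + √(n : ℝ)) - t) *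
        ((0.92 : ℝ) ^ (2 * n) / (n : ℝ) ^ (n - 1)) := by
  have hnR : (13 : ℝ) ≤ n := by exact_mod_cast hn
  have hn0 : (0 : ℝ) < n := by linarith
  obtain ⟨m, rfl⟩ : ∃ m, n = m + 1 := ⟨n - 1, by omega⟩
  rw [remainderBound, mul_assoc, Nat.add_sub_cancel]
  set N : ℝ := ((m + 1 : ℕ) : ℝ) with hN
  set s := √N with hs
  have hsq : s ^ 2 = N := Real.sq_sqrt hn0.le
  have hs0 : 0 < s := Real.sqrt_pos.2 hn0
  have hs36 : 3.605 ≤ s := Real.le_sqrt_of_sq_le (by norm_num; linarith)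
  have htx : 0 < s / (1 + s) - t := by linarith
  refine mul_le_mul_of_nonneg_left ?_ (by positivity)
  set E := Real.exp 1
  have hE0 : 0 < E := Real.exp_pos 1
  have hE : E ≤ 2.7183 := by have := Real.exp_one_lt_d9; linarith
  have hx : 1 - s / (1 + s) = (1 + s)⁻¹ := by field_simp; ring
  have hinv : s⁻¹ ≤ 0.2774 := by
    rw [inv_le_comm₀ hs0 (by norm_num)]
    refine le_trans (by norm_num) hs36
  set r : ℝ := E / 4 * (1 + s⁻¹) with hr
  have hr0 : 0 ≤ r := by positivity
  -- The base r at n = 13 is slightly below 0.92; the surplus 0.9437, raised to a power at least 26,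
  -- absorbs the factor 2(1 + 1/√n).
  have hrle : r ≤ 0.92 * 0.9437 := by
    calc r ≤ 2.7183 / 4 * (1 + 0.2774) := by rw [hr]; gcongr
      _ ≤ _ := by norm_num
  have hpow : (0.9437 : ℝ) ^ (2 * (m + 1)) ≤ 0.3 := by
    calc (0.9437 : ℝ) ^ (2 * (m + 1)) ≤ 0.9437 ^ 26 :=
          pow_le_pow_of_le_one (by norm_num) (by norm_num) (by omega)
      _ ≤ _ := by norm_num
  calc 2 * (s / (1 + s)) / (1 - s / (1 + s)) ^ (2 * (m + 1) + 2) * gammaCoeff (m + 1)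
      ≤ 2 * (s / (1 + s)) / (1 - s / (1 + s)) ^ (2 * (m + 1) + 2) *
        (E / (4 * N)) ^ (2 * (m + 1)) := by
        gcongr
        · rw [hx]; positivity
        · exact gammaCoeff_le (by omega)
    _ = 2 * (1 + s⁻¹) * r ^ (2 * (m + 1)) / N ^ m := by
        rw [hx, hr, ← hsq, inv_pow, div_pow, mul_pow, mul_pow, div_pow, ← pow_mul s 2 m,
          show 1 + s⁻¹ = (1 + s) / s by field_simp; ring, div_pow, pow_succ (1 + s) (2 * (m + 1) + 1),
          pow_succ (1 + s) (2 * (m + 1)), ← pow_mul s 2 (2 * (m + 1))]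
        rw [show s ^ (2 * (2 * (m + 1))) = s ^ (2 * (m + 1)) * s ^ (2 * m) * s ^ 2 by
          rw [← pow_add, ← pow_add]; congr 1; ring]
        field_simp
    _ ≤ 2 * (1 + 0.2774) * (0.92 * 0.9437) ^ (2 * (m + 1)) / N ^ m := by gcongr
    _ ≤ 2 * (1 + 0.2774) * (0.92 ^ (2 * (m + 1)) * 0.3) / N ^ m := by
        rw [mul_pow]; gcongr
    _ ≤ 0.92 ^ (2 * (m + 1)) / N ^ m := by
        gcongr
        have : (0 : ℝ) ≤ 0.92 ^ (2 * (m + 1)) := by positivity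
        linarith

theorem nZero_le_iff {x : ℝ} {n : ℕ} : nZero x ≤ n ↔ 13 ≤ n ∧ x ^ 2 / (1 - x) ^ 2 ≤ n + 1 := by
  rw [nZero, sub_le_iff_le_add, max_le_iff]
  refine and_congr_left fun _ => ?_
  rw [show (14 : ℝ) = 13 + 1 by norm_num, add_le_add_iff_right]
  norm_cast

/-- The estimate; its sharpness in the order of `n` for `|z|` close to `x`, in every direction `u`;
and the special case `x = x_n`. -/
theorem theorem1 :
    (∀ (f : ℂ → ℂ), HasUnitTaylorCoeffs f →
      ∀ (x : ℝ), 0 < x → x < 1 → ∀ (n : ℕ), nZero x ≤ (n : ℝ) →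
        ∀ (z : ℂ), ‖z‖ < x → ‖diffRemainder n f z‖ ≤ remainderBound n x ‖z‖) ∧
    (∀ (u : ℂ), ‖u‖ = 1 → ∃ f : ℂ → ℂ, HasUnitTaylorCoeffs f ∧
      ∀ (x : ℝ), 0 < x → x < 1 → ∀ (n : ℕ), nZero x ≤ (n : ℝ) →
        (∀ (t : ℝ), 0 ≤ t → t ≤ x →
          t ^ (2 * n + 1) / (1 - t) ^ (2 * n + 2) * gammaCoeff n
            ≤ ‖diffRemainder n f ((t : ℂ) * u)‖) ∧
        (∀ (t : ℝ), 0 ≤ t → t < x → x - t ≤ (1 - x) / ((n : ℝ) + 1) →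
          Real.exp (-2) * ((x - t) / (2 * x)) * remainderBound n x t
            ≤ ‖diffRemainder n f ((t : ℂ) * u)‖)) ∧
    (∀ (f : ℂ → ℂ), HasUnitTaylorCoeffs f →
      ∀ (n : ℕ), 13 ≤ n → ∀ (z : ℂ), ‖z‖ < √(n : ℝ) / (1 + √(n : ℝ)) →
        ‖diffRemainder n f z‖ ≤
          ‖z‖ ^ (2 * n + 1) / (√(n : ℝ) / (1 + √(n : ℝ)) - ‖z‖) *
            ((0.92 : ℝ) ^ (2 * n) / (n : ℝ) ^ (n - 1))) := by
  refine ⟨fun f hf x hx0 hx1 n hn z hz => ?_, fun u hu => ?_, fun f hf n hn z hz => ?_⟩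
  · obtain ⟨hn, hxn⟩ := nZero_le_iff.1 hn
    exact norm_diffRemainder_le hf hn hx0 hx1 hxn hz
  · have hu0 : u ≠ 0 := norm_pos_iff.1 (by rw [hu]; exact one_pos)
    have hlower : ∀ (x : ℝ), 0 < x → x < 1 → ∀ (n : ℕ), nZero x ≤ (n : ℝ) →
        ∀ (t : ℝ), 0 ≤ t → t ≤ x → t ^ (2 * n + 1) / (1 - t) ^ (2 * n + 2) * gammaCoeff n
          ≤ ‖diffRemainder n (fun z => (1 - u⁻¹ * z)⁻¹) ((t : ℂ) * u)‖ := by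
      intro x _ hx1 n hn t ht0 htx
      obtain ⟨hn, hxn⟩ := nZero_le_iff.1 hn
      rw [diffRemainder_comp_mul n (fun z => (1 - z)⁻¹) u⁻¹, mul_comm (t : ℂ) u,
        inv_mul_cancel_left₀ hu0]
      exact le_norm_diffRemainder_geometric hn hx1 hxn ht0 htx
    -- The geometric series rotated so that its pole sits at u: along the ray tu it reduces to the
    -- real case, with the same f for all x and n.
    refine ⟨fun z => (1 - u⁻¹ * z)⁻¹, ⟨fun m => u⁻¹ ^ m, fun m => by simp [hu], fun z hz => ?_⟩,
      fun x hx0 hx1 n hn => ⟨hlower x hx0 hx1 n hn, fun t ht0 htx ht => ?_⟩⟩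
    · simpa [mul_pow] using
        hasSum_geometric_of_norm_lt_one (ξ := u⁻¹ * z) (by simpa [hu] using hz)
    · exact (exp_neg_two_mul_remainderBound_le hx0 hx1 ht0 htx ht).trans
        (hlower x hx0 hx1 n hn t ht0 htx.le)
  · have hn0 : (0 : ℝ) < n := by exact_mod_cast (by omega : 0 < n)
    have hs0 : 0 < √(n : ℝ) := Real.sqrt_pos.2 hn0
    have hx1 : √(n : ℝ) / (1 + √(n : ℝ)) < 1 := by rw [div_lt_one (by positivity)]; linarith
    have hxn : (√(n : ℝ) / (1 + √(n : ℝ))) ^ 2 / (1 - √(n : ℝ) / (1 + √(n : ℝ))) ^ 2 ≤ n + 1 := by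
      rw [← div_pow, show √(n : ℝ) / (1 + √(n : ℝ)) / (1 - √(n : ℝ) / (1 + √(n : ℝ))) = √(n : ℝ) by
        field_simp; ring, Real.sq_sqrt hn0.le]
      linarith
    exact (norm_diffRemainder_le hf hn (by positivity) hx1 hxn hz).trans
      (remainderBound_sqrt_le hn (norm_nonneg z) hz)
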